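/- Let $\mathbb K$ be an algebraically closed field of characteristic $0$, let $N$ be a lattice of rank $n$ with dual lattice $M=\mathrm{Hom}(N,\mathbb Z)$ and pairing $\langle\cdot,\cdot\rangle$, and let $\sigma\subseteq N_{\mathbb Q}$ be a strongly convex polyhedral cone. Let $X_\sigma=\mathrm{Spec}\,\mathbb K[S_\sigma]$ with $S_\sigma=\sigma^\vee\cap M$ and $\mathbb K[S_\sigma]=\bigoplus_{u\in S_\sigma}\mathbb K\chi^u$ be the corresponding affine toric variety. Let $\tau$ be a $k$-dimensional regular face of $\sigma$, i.e. a face whose primitive ray vectors $p_1,\dots,p_k$ form part of a basis of $N$. Let $T$ be a torus of dimension $n-k$ with character lattice $L$, let $\chi_1,\dots,\chi_k\in L$, and let $G_{\overline\chi}=\mathbb G_a^k\rtimes T$ be the algebraic group with multiplication $(\overline\alpha,t)(\overline\alpha',t')=\bigl((\alpha_r+\chi_r(t)\alpha'_r)_{r},\,tt'\bigr)$. (Thus $\dim G_{\overline\chi}=n=\dim X_\sigma$.) Then there is a structure of algebraic monoid on $X_\sigma$ whose group of invertible elements (an open subvariety of $X_\sigma$) is isomorphic, as an algebraic group, to $G_{\overline\chi}$.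 Moreover, it can be realized by Demazure roots with prescribed differences, as follows. An element $e\in M$ is a Demazure root of $\sigma$ if $\langle q,e\rangle=-1$ for the primitive vector $q$ of one ray of $\sigma$ and $\langle q',e\rangle\ge 0$ for the primitive vectors $q'$ of all other rays. For every isomorphism $\varphi\colon L\to\tau^\perp\cap M$ there are Demazure roots $e_1^{(r)},e_2^{(r)}$ of $\sigma$ ($r=1,\dots,k$) with $\langle p_s,e_1^{(r)}\rangle=\langle p_s,e_2^{(r)}\rangle=-\delta_{rs}$ for all $r,s$ and $e_2^{(r)}-e_1^{(r)}=\varphi(\chi_r)$ for all $r$, such that the comultiplication $$\chi^u\mapsto \chi^u\otimes\chi^u\prod_{r=1}^k\bigl(1\otimes\chi^{e_1^{(r)}}+\chi^{e_2^{(r)}}\otimes 1\bigr)^{\langle p_r,u\rangle},\qquad u\in S_\sigma,$$ defines a monoid structure on $X_\sigma$ whose group of invertible elements is isomorphic to $G_{\overline\chi}$. -/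

import Mathlib

open CategoryTheory AlgebraicGeometry MonoidalCategory CartesianMonoidalCategory TensorProduct
open scoped MonObj

universe u

noncomputable section

namespace RootMonoid

/-! ### Cones in a lattice -/

section Cones

variable {N : Type u} [AddCommGroup N]

/-- The pairing `⟨v, u⟩` of a vector `v` of `N_ℚ = ℚ ⊗ N` with an element `u` of the dual lattice
`M = Hom(N, ℤ)`: it is the `ℚ`-linear function of `v` with `⟨a ⊗ x, u⟩ = a * u x`. -/
def pairing (u : Module.Dual ℤ N) : ℚ ⊗[ℤ] N →ₗ[ℚ] ℚ :=
  Module.Dual.baseChange ℚ u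

theorem pairing_tmul (u : Module.Dual ℤ N) (a : ℚ) (x : N) :
    pairing u (a ⊗ₜ[ℤ] x) = a * (u x : ℚ) := by
  simp [pairing, mul_comm]

theorem pairing_zero : pairing (0 : Module.Dual ℤ N) = 0 := by
  simp [pairing]

theorem pairing_add (u w : Module.Dual ℤ N) : pairing (u + w) = pairing u + pairing w := by
  simp [pairing]

theorem pairing_smul (c : ℤ) (u : Module.Dual ℤ N) : pairing (c • u) = c • pairing u := by
  simp [pairing]

/-- The semigroup `S_σ = σ^∨ ∩ M`. -/
def dualSemigroup (σ : PointedCone ℚ (ℚ ⊗[ℤ] N)) : AddSubmonoid (Module.Dual ℤ N) where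
  carrier := {u | ∀ v ∈ σ, 0 ≤ pairing u v}
  zero_mem' := by simp [pairing_zero]
  add_mem' := by
    intro a b ha hb v hv
    rw [pairing_add]
    exact add_nonneg (ha v hv) (hb v hv)

/-- The sublattice `τ^⊥ ∩ M` of `M`. -/
def perp (τ : PointedCone ℚ (ℚ ⊗[ℤ] N)) : Submodule ℤ (Module.Dual ℤ N) where
  carrier := {u | ∀ v ∈ τ, pairing u v = 0}
  zero_mem' := by simp [pairing_zero]
  add_mem' := by
    intro a b ha hb v hv
    rw [pairing_add, LinearMap.add_apply, ha v hv, hb v hv, add_zero]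
  smul_mem' := by
    intro c a ha v hv
    rw [pairing_smul, LinearMap.smul_apply, ha v hv, smul_zero]

/-- `τ` is a face of the (rational polyhedral) cone `σ`: it is the intersection of `σ` with the
supporting hyperplane `u^⊥` of some `u ∈ σ^∨ ∩ M`. -/
def IsFace (τ σ : PointedCone ℚ (ℚ ⊗[ℤ] N)) : Prop :=
  ∃ u ∈ dualSemigroup σ, ∀ v, v ∈ τ ↔ v ∈ σ ∧ pairing u v = 0

/-- The cone in `N_ℚ` generated by a set of lattice vectors. -/
def coneOf (s : Set N) : PointedCone ℚ (ℚ ⊗[ℤ] N) :=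
  PointedCone.hull ℚ ((fun x : N ↦ (1 : ℚ) ⊗ₜ[ℤ] x) '' s)

/-- A lattice vector is primitive if it is nonzero and not a proper multiple of another lattice
vector. -/
def IsPrimitive (q : N) : Prop :=
  q ≠ 0 ∧ ∀ (m : ℤ) (x : N), q = m • x → IsUnit m

/-- `q` is the primitive vector on a ray (one-dimensional face) of `σ`. -/
def IsRayVector (σ : PointedCone ℚ (ℚ ⊗[ℤ] N)) (q : N) : Prop :=
  IsPrimitive q ∧ IsFace (coneOf {q}) σ

/-- `τ` is a `k`-dimensional regular cone, and `p₁, …, p_k` are the primitive vectors on its rays: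
the `p_r` are part of a basis of the lattice, and `τ` is the cone generated by them. -/
def IsRegularCone {k : ℕ} (p : Fin k → N) (τ : PointedCone ℚ (ℚ ⊗[ℤ] N)) : Prop :=
  (∃ (m : ℕ) (b : Module.Basis (Fin k ⊕ Fin m) ℤ N), ∀ r, b (Sum.inl r) = p r) ∧
    τ = coneOf (Set.range p)

/-- `e ∈ M` is a Demazure root of `σ`: it takes the value `-1` on the primitive vector of one ray
of `σ`, and nonnegative values on the primitive vectors of all other rays. -/
def IsDemazureRoot (σ : PointedCone ℚ (ℚ ⊗[ℤ] N)) (e : Module.Dual ℤ N) : Prop :=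
  ∃ q, IsRayVector σ q ∧ e q = -1 ∧ ∀ q', IsRayVector σ q' → q' ≠ q → 0 ≤ e q'

/-- The Demazure roots `e₁⁽ʳ⁾, e₂⁽ʳ⁾` of `σ` are compatible with the regular face whose rays have
the primitive vectors `p₁, …, p_k`: `⟨p_s, e₁⁽ʳ⁾⟩ = ⟨p_s, e₂⁽ʳ⁾⟩ = -δ_{rs}`. -/
structure AreCompatibleRoots {k : ℕ} (σ : PointedCone ℚ (ℚ ⊗[ℤ] N)) (p : Fin k → N)
    (e₁ e₂ : Fin k → Module.Dual ℤ N) : Prop where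
  isRoot₁ : ∀ r, IsDemazureRoot σ (e₁ r)
  isRoot₂ : ∀ r, IsDemazureRoot σ (e₂ r)
  apply₁ : ∀ r s, e₁ r (p s) = if r = s then -1 else 0
  apply₂ : ∀ r s, e₂ r (p s) = if r = s then -1 else 0

end Cones

/-! ### Affine toric varieties and monoid structures on them -/

section Toric

variable (K : Type u) [Field K] {N : Type u} [AddCommGroup N]

/-- The algebra `K[X_σ] = K[S_σ] = ⨁_{u ∈ S_σ} K χ^u`. -/
abbrev ToricRing (σ : PointedCone ℚ (ℚ ⊗[ℤ] N)) : Type u :=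
  AddMonoidAlgebra K (dualSemigroup σ)

/-- The affine toric variety `X_σ = Spec K[S_σ]`, as a scheme over `K`. -/
def toricVariety (σ : PointedCone ℚ (ℚ ⊗[ℤ] N)) : Over (Spec (.of K)) :=
  (Spec (.of (ToricRing K σ))).asOver (Spec (.of K))

/-- The inclusion of `K[S_σ]` into the algebra `K[M] = ⨁_{u ∈ M} K χ^u` of Laurent polynomials. -/
def toLaurent (σ : PointedCone ℚ (ℚ ⊗[ℤ] N)) :
    ToricRing K σ →ₐ[K] AddMonoidAlgebra K (Module.Dual ℤ N) :=
  AddMonoidAlgebra.mapDomainAlgHom K K (dualSemigroup σ).subtype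

/-- The character `χ^u`, `u ∈ M`, as an element of `K[M]`. -/
def chi (u : Module.Dual ℤ N) : AddMonoidAlgebra K (Module.Dual ℤ N) :=
  AddMonoidAlgebra.single u 1

variable {K}

/-- The given monoid structure on `X_σ` is the one of the root monoid of `e₁⁽ʳ⁾, e₂⁽ʳ⁾`: the
multiplication `X_σ × X_σ = Spec (K[X_σ] ⊗ K[X_σ]) → X_σ` is dual to an algebra homomorphism `Δ`
which, after the inclusion of `K[X_σ] ⊗ K[X_σ]` into `K[M] ⊗ K[M]`, is given by
`χ^u ↦ (χ^u ⊗ χ^u) ∏_r (1 ⊗ χ^{e₁⁽ʳ⁾} + χ^{e₂⁽ʳ⁾} ⊗ 1) ^ ⟨p_r, u⟩`.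
(The exponents are nonnegative for `p_r ∈ σ` and `u ∈ S_σ`.) -/
def IsRootMonoid {k : ℕ} (σ : PointedCone ℚ (ℚ ⊗[ℤ] N)) (p : Fin k → N)
    (e₁ e₂ : Fin k → Module.Dual ℤ N) (μX : MonObj (toricVariety K σ)) : Prop :=
  ∃ Δ : ToricRing K σ →ₐ[K] ToricRing K σ ⊗[K] ToricRing K σ,
    (∀ u : dualSemigroup σ,
      Algebra.TensorProduct.map (toLaurent K σ) (toLaurent K σ) (Δ (AddMonoidAlgebra.single u 1)) =
        (chi K (u : Module.Dual ℤ N) ⊗ₜ[K] chi K (u : Module.Dual ℤ N)) *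
          ∏ r, (1 ⊗ₜ[K] chi K (e₁ r) + chi K (e₂ r) ⊗ₜ[K] 1) ^
            ((u : Module.Dual ℤ N) (p r)).toNat) ∧
    μX.mul.left =
      (pullbackSpecIso K (ToricRing K σ) (ToricRing K σ)).hom ≫
        Spec.map (CommRingCat.ofHom Δ.toRingHom)

end Toric

/-! ### The semidirect product `G_χ = 𝔾_a^k ⋊ T` -/

section Semidirect

variable (K : Type u) [Field K] {L : Type u} [AddCommGroup L] {k : ℕ}

/-- The coordinate ring of `G_χ = 𝔾_a^k ⋊ T`, where `T = Spec K[L]` is the torus with character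
lattice `L` and `χ₁, …, χ_k ∈ L`. As an algebra it is `K[T][α₁, …, α_k]`; the characters `χ_r` only
enter into the Hopf algebra structure below. -/
def SemidirectRing (_χ : Fin k → L) : Type u :=
  MvPolynomial (Fin k) (AddMonoidAlgebra K L)

namespace SemidirectRing

variable (χ : Fin k → L)

instance : CommRing (SemidirectRing K χ) :=
  inferInstanceAs (CommRing (MvPolynomial (Fin k) (AddMonoidAlgebra K L)))

instance : Algebra K (SemidirectRing K χ) :=
  inferInstanceAs (Algebra K (MvPolynomial (Fin k) (AddMonoidAlgebra K L)))

/-- The coordinate function `α_r` on `G_χ`, `α_r(α, t) = α_r`. -/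
def coord (r : Fin k) : SemidirectRing K χ :=
  (MvPolynomial.X r : MvPolynomial (Fin k) (AddMonoidAlgebra K L))

/-- The character of `T` given by `l ∈ L`, as a function on `G_χ`: `(α, t) ↦ l(t)`. -/
def char (l : L) : SemidirectRing K χ :=
  (MvPolynomial.C (AddMonoidAlgebra.single l 1) : MvPolynomial (Fin k) (AddMonoidAlgebra K L))

theorem char_zero : char K χ 0 = 1 :=
  (MvPolynomial.C : AddMonoidAlgebra K L →+* MvPolynomial (Fin k) (AddMonoidAlgebra K L)).map_one

theorem char_add (l l' : L) : char K χ (l + l') = char K χ l * char K χ l' := by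
  have h : (AddMonoidAlgebra.single (l + l') 1 : AddMonoidAlgebra K L) =
      AddMonoidAlgebra.single l 1 * AddMonoidAlgebra.single l' 1 := by
    simp [AddMonoidAlgebra.single_mul_single]
  unfold char
  rw [h]
  exact (MvPolynomial.C : AddMonoidAlgebra K L →+*
    MvPolynomial (Fin k) (AddMonoidAlgebra K L)).map_mul _ _

variable {K χ}

theorem algHom_ext {B : Type*} [CommSemiring B] [Algebra K B] {f g : SemidirectRing K χ →ₐ[K] B}
    (hchar : ∀ l, f (char K χ l) = g (char K χ l))
    (hcoord : ∀ r, f (coord K χ r) = g (coord K χ r)) :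
    f = g := by
  let f' : MvPolynomial (Fin k) (AddMonoidAlgebra K L) →ₐ[K] B := f
  let g' : MvPolynomial (Fin k) (AddMonoidAlgebra K L) →ₐ[K] B := g
  have h : f'.comp (IsScalarTower.toAlgHom K (AddMonoidAlgebra K L) _) =
      g'.comp (IsScalarTower.toAlgHom K (AddMonoidAlgebra K L) _) :=
    AddMonoidAlgebra.algHom_ext hchar (Subsingleton.elim _ _)
  exact MvPolynomial.algHom_ext' h hcoord

/-- The algebra homomorphism out of the coordinate ring with prescribed values on the characters
of `T` and on the coordinates. -/
def lift {B : Type*} [CommSemiring B] [Algebra K B] (f : Multiplicative L →* B) (x : Fin k → B) :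
    SemidirectRing K χ →ₐ[K] B :=
  (MvPolynomial.aevalTower (AddMonoidAlgebra.lift K B L f) x :
    MvPolynomial (Fin k) (AddMonoidAlgebra K L) →ₐ[K] B)

theorem lift_char {B : Type*} [CommSemiring B] [Algebra K B] (f : Multiplicative L →* B)
    (x : Fin k → B) (l : L) : lift (χ := χ) f x (char K χ l) = f (Multiplicative.ofAdd l) := by
  refine (MvPolynomial.aevalTower_C (AddMonoidAlgebra.lift K B L f) x _).trans ?_
  simp

theorem lift_coord {B : Type*} [CommSemiring B] [Algebra K B] (f : Multiplicative L →* B)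
    (x : Fin k → B) (r : Fin k) : lift (χ := χ) f x (coord K χ r) = x r :=
  MvPolynomial.aevalTower_X _ _ _

variable (K χ)

/-- The comultiplication of `G_χ`, dual to `(α, t) (α', t') = (α + χ(t) α', t t')`:
`l ↦ l ⊗ l` for the characters of `T`, and `α_r ↦ α_r ⊗ 1 + χ_r ⊗ α_r`. -/
def comulHom : SemidirectRing K χ →ₐ[K] SemidirectRing K χ ⊗[K] SemidirectRing K χ :=
  lift
    { toFun := fun l ↦ char K χ l.toAdd ⊗ₜ[K] char K χ l.toAdd
      map_one' := by simp [char_zero, Algebra.TensorProduct.one_def]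
      map_mul' := by simp [char_add] }
    (fun r ↦ coord K χ r ⊗ₜ[K] 1 + char K χ (χ r) ⊗ₜ[K] coord K χ r)

/-- The counit of `G_χ`: evaluation at the neutral element `(0, 1)`. -/
def counitHom : SemidirectRing K χ →ₐ[K] K :=
  lift 1 (fun _ ↦ 0)

/-- The antipode of `G_χ`, dual to `(α, t)⁻¹ = (-χ(t)⁻¹ α, t⁻¹)`. -/
def antipodeHom : SemidirectRing K χ →ₐ[K] SemidirectRing K χ :=
  lift
    { toFun := fun l ↦ char K χ (-l.toAdd)
      map_one' := by simp [char_zero]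
      map_mul' := by simp [char_add, add_comm] }
    (fun r ↦ -(char K χ (-χ r) * coord K χ r))

theorem comulHom_char (l : L) : comulHom K χ (char K χ l) = char K χ l ⊗ₜ[K] char K χ l :=
  lift_char _ _ _

theorem comulHom_coord (r : Fin k) : comulHom K χ (coord K χ r) =
    coord K χ r ⊗ₜ[K] 1 + char K χ (χ r) ⊗ₜ[K] coord K χ r :=
  lift_coord _ _ _

theorem counitHom_char (l : L) : counitHom K χ (char K χ l) = 1 :=
  lift_char _ _ _

theorem counitHom_coord (r : Fin k) : counitHom K χ (coord K χ r) = 0 :=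
  lift_coord _ _ _

theorem antipodeHom_char (l : L) : antipodeHom K χ (char K χ l) = char K χ (-l) :=
  lift_char _ _ _

theorem antipodeHom_coord (r : Fin k) :
    antipodeHom K χ (coord K χ r) = -(char K χ (-χ r) * coord K χ r) :=
  lift_coord _ _ _

instance : Bialgebra K (SemidirectRing K χ) :=
  Bialgebra.ofAlgHom (comulHom K χ) (counitHom K χ)
    (by
      apply algHom_ext
      · intro l
        simp [comulHom_char]
      · intro r
        simp [comulHom_char, comulHom_coord, TensorProduct.add_tmul, TensorProduct.tmul_add,
          Algebra.TensorProduct.one_def, add_assoc])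
    (by
      apply algHom_ext
      · intro l
        simp [comulHom_char, counitHom_char]
      · intro r
        simp [comulHom_coord, counitHom_char, counitHom_coord])
    (by
      apply algHom_ext
      · intro l
        simp [comulHom_char, counitHom_char]
      · intro r
        simp [comulHom_coord, counitHom_coord])

theorem comulAlgHom_eq : Bialgebra.comulAlgHom K (SemidirectRing K χ) = comulHom K χ := rfl

theorem counitAlgHom_eq : Bialgebra.counitAlgHom K (SemidirectRing K χ) = counitHom K χ := rfl

theorem char_neg_mul (l : L) : char K χ (-l) * char K χ l = 1 := by
  rw [← char_add, neg_add_cancel, char_zero]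

theorem char_mul_neg (l : L) : char K χ l * char K χ (-l) = 1 := by
  rw [← char_add, add_neg_cancel, char_zero]

instance : HopfAlgebra K (SemidirectRing K χ) :=
  HopfAlgebra.ofAlgHom (antipodeHom K χ)
    (by
      change (Algebra.TensorProduct.lift (antipodeHom K χ) (.id K (SemidirectRing K χ))
        fun _ _ ↦ Commute.all _ _).comp (comulHom K χ) = (Algebra.ofId K _).comp (counitHom K χ)
      apply algHom_ext
      · intro l
        rw [AlgHom.comp_apply, AlgHom.comp_apply, comulHom_char, counitHom_char,
          Algebra.TensorProduct.lift_tmul, antipodeHom_char, AlgHom.id_apply, char_neg_mul, map_one]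
      · intro r
        rw [AlgHom.comp_apply, AlgHom.comp_apply, comulHom_coord, counitHom_coord, map_add,
          Algebra.TensorProduct.lift_tmul, Algebra.TensorProduct.lift_tmul, antipodeHom_char,
          antipodeHom_coord, AlgHom.id_apply, AlgHom.id_apply, mul_one, neg_add_cancel, map_zero])
    (by
      rw [comulAlgHom_eq, counitAlgHom_eq]
      apply algHom_ext
      · intro l
        simp [comulHom_char, counitHom_char, antipodeHom_char, char_mul_neg]
      · intro r
        simp [comulHom_coord, counitHom_coord, antipodeHom_coord, ← mul_assoc, char_mul_neg])

end SemidirectRing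

/-- The scheme underlying `G_χ = 𝔾_a^k ⋊ T`, that is `𝔸^k × T`. -/
def semidirectGroup (χ : Fin k → L) : Over (Spec (.of K)) :=
  (Spec (.of (SemidirectRing K χ))).asOver (Spec (.of K))

/-- The algebraic group structure of `G_χ = 𝔾_a^k ⋊ T`. -/
instance (χ : Fin k → L) : GrpObj (semidirectGroup K χ) :=
  inferInstanceAs (GrpObj ((Spec (.of (SemidirectRing K χ))).asOver (Spec (.of K))))

end Semidirect

/-! ### The group of invertible elements -/

section Units

variable {K : Type u} [Field K]

/-- For an algebraic monoid `X` and an algebraic group `G` over `K`, the morphism `j : G ⟶ X`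
identifies `G` with the group of invertible elements of `X`: it is a homomorphism and an open
immersion, and the `K`-points of `X` in its image are exactly the invertible ones. -/
structure IsUnitGroup {X G : Over (Spec (.of K))} [MonObj X] [GrpObj G] (j : G ⟶ X) : Prop where
  isMonHom : IsMonHom j
  isOpenImmersion : IsOpenImmersion j.left
  isUnit_iff : ∀ x : 𝟙_ (Over (Spec (.of K))) ⟶ X,
    IsUnit x ↔ ∃ g : 𝟙_ (Over (Spec (.of K))) ⟶ G, g ≫ j = x

end Units

end RootMonoid

end

/-! Choose `w` in `S_σ` whose zero set on `σ` is the face `τ`. Since `τ` is regular, the open set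
`χ^w ≠ 0` of `X_σ` is isomorphic to `𝔸^k × T`, the variety of `G_χ`. It has to be shown that the
group law of this chart extends to all of `X_σ`.

Roots (`exists_compatible_roots`): take the negatives of the first `k` dual basis vectors, and their
translates by `φ(χ_r)`. Adding a multiple of `w` does not change the values on the `p_s`, and a
large multiple makes the values on the generators outside `τ` nonnegative, because `w` is positive
there. One multiple serves for both roots of a pair, so their difference stays `φ(χ_r)`.

Comultiplication: embed `K[G_χ]` in `K[M]` by `l ↦ χ^{φ l}`, `α_r ↦ χ^{-e₁⁽ʳ⁾}`. Then `1 ⊗ χ^{e₁} +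
χ^{e₂} ⊗ 1` is `χ^{e₁} ⊗ χ^{e₁}` times the image of `α_r ⊗ 1 + χ_r ⊗ α_r`, so the prescribed formula
is the comultiplication of `G_χ` restricted to `K[S_σ]` (`map_chart_comp_comul`). By binomial
expansion its values lie in `K[S_σ] ⊗ K[S_σ]` (`exists_comul`), and the bialgebra axioms are
inherited from `K[G_χ]`.

Units (`isUnitGroup_specHom`): `χ^w` is group-like, so it does not vanish at an invertible point,
which therefore lies in the chart. The points of the chart are invertible because it is a group. -/

noncomputable section

namespace RootMonoid

/-! ### Finitely generated cones and their primitive ray vectors. -/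

section Cones

variable {N : Type u} [AddCommGroup N]

theorem pairing_one_tmul (u : Module.Dual ℤ N) (x : N) :
    pairing u ((1 : ℚ) ⊗ₜ[ℤ] x) = (u x : ℚ) := by
  rw [pairing_tmul, one_mul]

theorem pairing_nonneg_of_mem_hull {G : Set (ℚ ⊗[ℤ] N)} {u : Module.Dual ℤ N}
    (h : ∀ g ∈ G, 0 ≤ pairing u g) {v : ℚ ⊗[ℤ] N} (hv : v ∈ PointedCone.hull ℚ G) :
    0 ≤ pairing u v := by
  induction hv using Submodule.span_induction with
  | mem x hx => exact h x hx
  | zero => simp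
  | add x y _ _ hx hy => rw [map_add]; exact add_nonneg hx hy
  | smul a x _ hx =>
    change 0 ≤ pairing u ((a : ℚ) • x)
    rw [map_smul]
    exact mul_nonneg a.2 hx

theorem tmul_mem_coneOf {s : Set N} {x : N} (hx : x ∈ s) : (1 : ℚ) ⊗ₜ[ℤ] x ∈ coneOf s :=
  Submodule.subset_span ⟨x, hx, rfl⟩

theorem mem_perp_coneOf_range {I : Type*} {p : I → N} {u : Module.Dual ℤ N} :
    u ∈ perp (coneOf (Set.range p)) ↔ ∀ s, u (p s) = 0 := by
  constructor
  · intro h s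
    have := h _ (tmul_mem_coneOf ⟨s, rfl⟩)
    rw [pairing_one_tmul] at this
    exact_mod_cast this
  · intro h v hv
    refine Submodule.span_induction (p := fun v _ ↦ pairing u v = 0) ?_ ?_ ?_ ?_ hv
    · rintro _ ⟨_, ⟨s, rfl⟩, rfl⟩
      simp [pairing_one_tmul, h]
    · simp
    · intro x y _ _ hx hy
      rw [map_add, hx, hy, add_zero]
    · intro a x _ hx
      change pairing u ((a : ℚ) • x) = 0
      rw [map_smul, hx, smul_zero]

theorem mem_coneOf_singleton {q : N} {v : ℚ ⊗[ℤ] N} :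
    v ∈ coneOf {q} ↔ ∃ c : ℚ, 0 ≤ c ∧ v = c • ((1 : ℚ) ⊗ₜ[ℤ] q) := by
  unfold coneOf PointedCone.hull
  rw [Set.image_singleton, Submodule.mem_span_singleton]
  constructor
  · rintro ⟨a, rfl⟩
    exact ⟨a, a.2, rfl⟩
  · rintro ⟨c, hc, rfl⟩
    exact ⟨⟨c, hc⟩, rfl⟩

theorem mem_coneOf_range {k : ℕ} {p : Fin k → N} {v : ℚ ⊗[ℤ] N} :
    v ∈ coneOf (Set.range p) ↔
      ∃ c : Fin k → ℚ, (∀ s, 0 ≤ c s) ∧ v = ∑ s, c s • ((1 : ℚ) ⊗ₜ[ℤ] p s) := by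
  unfold coneOf PointedCone.hull
  rw [← Set.range_comp, Submodule.mem_span_range_iff_exists_fun]
  constructor
  · rintro ⟨c, rfl⟩
    exact ⟨fun s ↦ c s, fun s ↦ (c s).2, rfl⟩
  · rintro ⟨c, hc, rfl⟩
    exact ⟨fun s ↦ ⟨c s, hc s⟩, rfl⟩

theorem tmul_one_injective [Module.Free ℤ N] :
    Function.Injective (fun x : N ↦ (1 : ℚ) ⊗ₜ[ℤ] x) := by
  intro x y h
  refine (Module.Free.chooseBasis ℤ N).ext_elem fun i ↦ ?_
  have := congrArg (pairing ((Module.Free.chooseBasis ℤ N).coord i)) h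
  simp only [pairing_one_tmul] at this
  exact_mod_cast this

/-- Every ray vector of the cone generated by `G` is, up to a positive factor, an element of `G`. -/
theorem IsRayVector.exists_generator [Module.Free ℤ N] {G : Finset (ℚ ⊗[ℤ] N)} {q : N}
    (hq : IsRayVector (PointedCone.hull ℚ (G : Set (ℚ ⊗[ℤ] N))) q) :
    ∃ g ∈ G, ∃ c : ℚ, 0 < c ∧ g = c • ((1 : ℚ) ⊗ₜ[ℤ] q) := by
  obtain ⟨⟨hq0, -⟩, u, hu, hface⟩ := hq
  obtain ⟨hqσ, huq⟩ := (hface _).1 (tmul_mem_coneOf (Set.mem_singleton q))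
  obtain ⟨c, -, hc⟩ := Submodule.mem_span_finset.1 hqσ
  have hqne : (1 : ℚ) ⊗ₜ[ℤ] q ≠ 0 := by
    intro h
    apply hq0
    exact tmul_one_injective (by simpa using h)
  obtain ⟨g, hg, hne⟩ : ∃ g ∈ G, c g • g ≠ 0 := by
    by_contra! h
    rw [Finset.sum_eq_zero h] at hc
    exact hqne hc.symm
  have hgσ : ∀ g ∈ G, g ∈ PointedCone.hull ℚ (G : Set (ℚ ⊗[ℤ] N)) :=
    fun g hg ↦ Submodule.subset_span hg
  -- `u` vanishes at `q` and is nonnegative on every generator, so each generator that occurs in `q`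
  -- with nonzero coefficient lies on the ray.
  have hsum : ∑ g ∈ G, (c g : ℚ) * pairing u g = 0 := by
    refine Eq.trans ?_ huq
    rw [← hc, map_sum]
    refine Finset.sum_congr rfl fun g _ ↦ ?_
    change _ = pairing u ((c g : ℚ) • g)
    rw [map_smul, smul_eq_mul]
  have hterm := (Finset.sum_eq_zero_iff_of_nonneg
    fun g hg ↦ mul_nonneg (c g).2 (hu g (hgσ g hg))).1 hsum g hg
  have hcg : (c g : ℚ) ≠ 0 := by
    intro h
    apply hne
    change (c g : ℚ) • g = 0
    rw [h, zero_smul]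
  have hug : pairing u g = 0 := (mul_eq_zero.1 hterm).resolve_left hcg
  obtain ⟨a, ha, rfl⟩ := mem_coneOf_singleton.1 ((hface g).2 ⟨hgσ g hg, hug⟩)
  refine ⟨_, hg, a, lt_of_le_of_ne ha ?_, rfl⟩
  rintro rfl
  simp at hne

/-- With `c` in lowest terms, a Bézout relation makes `q` a multiple of the denominator, which is
therefore `1`; then `p` is a multiple of the numerator, which is `1` as well. -/
theorem IsPrimitive.eq_of_tmul_eq_smul [Module.Free ℤ N] {p q : N} (hp : IsPrimitive p)
    (hq : IsPrimitive q) {c : ℚ} (hc : 0 < c)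
    (h : (1 : ℚ) ⊗ₜ[ℤ] p = c • ((1 : ℚ) ⊗ₜ[ℤ] q)) : p = q := by
  have hd : (c.den : ℤ) • p = c.num • q := by
    apply tmul_one_injective
    change (1 : ℚ) ⊗ₜ[ℤ] ((c.den : ℤ) • p) = (1 : ℚ) ⊗ₜ[ℤ] (c.num • q)
    rw [TensorProduct.tmul_smul, TensorProduct.tmul_smul, h, ← Int.cast_smul_eq_zsmul ℚ,
      ← Int.cast_smul_eq_zsmul ℚ, smul_smul]
    congr 1
    push_cast
    rw [mul_comm]
    exact Rat.mul_den_eq_num c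
  obtain ⟨x, y, hxy⟩ : IsCoprime (c.den : ℤ) c.num :=
    (Int.isCoprime_iff_gcd_eq_one.2 (by simpa [Int.gcd, Nat.Coprime] using c.reduced)).symm
  have hden : IsUnit (c.den : ℤ) := by
    apply hq.2 _ (x • q + y • p)
    calc q = (x * c.den + y * c.num) • q := by rw [hxy, one_smul]
      _ = (c.den : ℤ) • x • q + y • c.num • q := by module
      _ = (c.den : ℤ) • x • q + y • (c.den : ℤ) • p := by rw [hd]
      _ = _ := by module
  have h1 : (c.den : ℤ) = 1 := by
    rcases Int.isUnit_iff.1 hden with h | h <;> omega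
  rw [h1, one_smul] at hd
  have hnum := hp.2 _ _ hd
  have : 0 < c.num := Rat.num_pos.2 hc
  have h2 : c.num = 1 := by
    rcases Int.isUnit_iff.1 hnum with h | h <;> omega
  rw [hd, h2, one_smul]

end Cones
-- Regular faces, their rays and Demazure roots.
section Faces

variable {N : Type u} [AddCommGroup N]

theorem smul_mem_pointedCone {σ : PointedCone ℚ (ℚ ⊗[ℤ] N)} {c : ℚ} (hc : 0 ≤ c)
    {v : ℚ ⊗[ℤ] N} (hv : v ∈ σ) : c • v ∈ σ :=
  Submodule.smul_mem σ (⟨c, hc⟩ : {c : ℚ // 0 ≤ c}) hv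

/-- The elements of `M` that are nonnegative on those vectors of `G` that do not lie in `τ`. -/
def offFace (G : Finset (ℚ ⊗[ℤ] N)) (τ : PointedCone ℚ (ℚ ⊗[ℤ] N)) :
    AddSubmonoid (Module.Dual ℤ N) where
  carrier := {u | ∀ g ∈ G, g ∉ τ → 0 ≤ pairing u g}
  zero_mem' := by simp [pairing_zero]
  add_mem' := by
    intro a b ha hb g hg hgτ
    rw [pairing_add]
    exact add_nonneg (ha g hg hgτ) (hb g hg hgτ)

/-- What the algebra of a regular face with ray vectors `p` needs to know about the cone: `w`
supports the face, and `O` consists of the elements of `M` that are nonnegative outside it. -/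
structure IsRegularFaceData {k : ℕ} (σ : PointedCone ℚ (ℚ ⊗[ℤ] N)) (p : Fin k → N)
    (O : AddSubmonoid (Module.Dual ℤ N)) (w : Module.Dual ℤ N) : Prop where
  mem_dual_iff : ∀ u, u ∈ dualSemigroup σ ↔ u ∈ O ∧ ∀ s, 0 ≤ u (p s)
  apply_eq_zero : ∀ s, w (p s) = 0
  mem : w ∈ O
  absorb : ∀ u, ∃ n : ℕ, u + n • w ∈ O

variable {k : ℕ} {p : Fin k → N} {G : Finset (ℚ ⊗[ℤ] N)} {w : Module.Dual ℤ N}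

theorem mem_dualSemigroup_hull_iff
    (hp : ∀ s, (1 : ℚ) ⊗ₜ[ℤ] p s ∈ PointedCone.hull ℚ (G : Set (ℚ ⊗[ℤ] N)))
    (u : Module.Dual ℤ N) :
    u ∈ dualSemigroup (PointedCone.hull ℚ (G : Set (ℚ ⊗[ℤ] N))) ↔
      u ∈ offFace G (coneOf (Set.range p)) ∧ ∀ s, 0 ≤ u (p s) := by
  constructor
  · refine fun h ↦ ⟨fun g hg _ ↦ h g (Submodule.subset_span hg), fun s ↦ ?_⟩
    have := h _ (hp s)
    rw [pairing_one_tmul] at this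
    exact_mod_cast this
  · rintro ⟨hO, hs⟩ v hv
    refine pairing_nonneg_of_mem_hull (fun g hg ↦ ?_) hv
    by_cases hgτ : g ∈ coneOf (Set.range p)
    · refine pairing_nonneg_of_mem_hull ?_ hgτ
      rintro _ ⟨_, ⟨s, rfl⟩, rfl⟩
      rw [pairing_one_tmul]
      exact_mod_cast hs s
    · exact hO g hg hgτ

theorem isRegularFaceData_offFace
    (hw : w ∈ dualSemigroup (PointedCone.hull ℚ (G : Set (ℚ ⊗[ℤ] N))))
    (hface : ∀ v, v ∈ coneOf (Set.range p) ↔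
      v ∈ PointedCone.hull ℚ (G : Set (ℚ ⊗[ℤ] N)) ∧ pairing w v = 0) :
    IsRegularFaceData (PointedCone.hull ℚ (G : Set (ℚ ⊗[ℤ] N))) p
      (offFace G (coneOf (Set.range p))) w where
  mem_dual_iff := mem_dualSemigroup_hull_iff
    fun s ↦ ((hface _).1 (tmul_mem_coneOf ⟨s, rfl⟩)).1
  apply_eq_zero s := by
    have := ((hface _).1 (tmul_mem_coneOf ⟨s, rfl⟩)).2
    rw [pairing_one_tmul] at this
    exact_mod_cast this
  mem g hg _ := hw g (Submodule.subset_span hg)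
  absorb u := by
    -- A generator killed by `w` lies in the face, so `w` is positive on the finitely many others,
    -- and one large `n` works for all of them.
    have key : ∀ᶠ n : ℕ in Filter.atTop, ∀ g ∈ G, g ∉ coneOf (Set.range p) →
        0 ≤ pairing (u + n • w) g := by
      rw [Filter.eventually_all_finset]
      intro g hg
      by_cases hgτ : g ∈ coneOf (Set.range p)
      · simp [hgτ]
      have hgσ : g ∈ PointedCone.hull ℚ (G : Set (ℚ ⊗[ℤ] N)) := Submodule.subset_span hg
      have hpos : 0 < pairing w g :=
        lt_of_le_of_ne (hw g hgσ) fun h ↦ hgτ ((hface g).2 ⟨hgσ, h.symm⟩)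
      obtain ⟨m, hm⟩ := exists_nat_ge (-pairing u g / pairing w g)
      filter_upwards [Filter.eventually_ge_atTop m] with n hn _
      have hn' : (m : ℚ) ≤ n := by exact_mod_cast hn
      have := (div_le_iff₀ hpos).1 (hm.trans hn')
      rw [pairing_add, ← natCast_zsmul, pairing_smul, LinearMap.add_apply, LinearMap.smul_apply,
        zsmul_eq_mul, Int.cast_natCast]
      linarith
    obtain ⟨n, hn⟩ := key.exists
    exact ⟨n, hn⟩

namespace IsRegularFaceData

variable {σ : PointedCone ℚ (ℚ ⊗[ℤ] N)} {O : AddSubmonoid (Module.Dual ℤ N)}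

theorem mem_dualSemigroup (h : IsRegularFaceData σ p O w) : w ∈ dualSemigroup σ :=
  (h.mem_dual_iff w).2 ⟨h.mem, fun s ↦ (h.apply_eq_zero s).ge⟩

theorem add_nsmul_apply (h : IsRegularFaceData σ p O w) (u : Module.Dual ℤ N) (n : ℕ) (s : Fin k) :
    (u + n • w) (p s) = u (p s) := by
  simp [h.apply_eq_zero]

theorem exists_mem_dualSemigroup (h : IsRegularFaceData σ p O w) {u : Module.Dual ℤ N}
    (hu : ∀ s, 0 ≤ u (p s)) : ∃ n : ℕ, u + n • w ∈ dualSemigroup σ := by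
  obtain ⟨n, hn⟩ := h.absorb u
  exact ⟨n, (h.mem_dual_iff _).2 ⟨hn, fun s ↦ by rw [h.add_nsmul_apply]; exact hu s⟩⟩

/-- The shift is common to `u` and `v` so that it preserves `v - u`. -/
theorem exists_pair_mem (h : IsRegularFaceData σ p O w) (u v : Module.Dual ℤ N) :
    ∃ n : ℕ, u + n • w ∈ O ∧ v + n • w ∈ O := by
  obtain ⟨m, hm⟩ := h.absorb u
  obtain ⟨n, hn⟩ := h.absorb v
  refine ⟨m + n, ?_, ?_⟩
  · rw [add_nsmul, ← add_assoc]
    exact add_mem hm (nsmul_mem h.mem n)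
  · rw [add_comm m n, add_nsmul, ← add_assoc]
    exact add_mem hn (nsmul_mem h.mem m)

end IsRegularFaceData

theorem isPrimitive_basis {I : Type*} (b : Module.Basis I ℤ N) (i : I) : IsPrimitive (b i) := by
  classical
  refine ⟨b.ne_zero i, fun m x hx ↦ ?_⟩
  have := congrArg (fun y ↦ b.repr y i) hx
  simp only [Module.Basis.repr_self, Finsupp.single_eq_same, map_smul, Finsupp.smul_apply,
    smul_eq_mul] at this
  exact IsUnit.of_mul_eq_one _ this.symm

/-- The vectors of a regular face that are part of a basis are ray vectors of the whole cone. -/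
theorem isRayVector_of_basis {m : ℕ} {σ : PointedCone ℚ (ℚ ⊗[ℤ] N)}
    (b : Module.Basis (Fin k ⊕ Fin m) ℤ N) (hb : ∀ r, b (Sum.inl r) = p r)
    {O : AddSubmonoid (Module.Dual ℤ N)} (hO : IsRegularFaceData σ p O w)
    (hface : ∀ v, v ∈ coneOf (Set.range p) ↔ v ∈ σ ∧ pairing w v = 0) (r : Fin k) :
    IsRayVector σ (p r) := by
  refine ⟨hb r ▸ isPrimitive_basis b _, ?_⟩
  -- Within the face, `z` vanishes exactly on the ray of `p r`.
  let z : Module.Dual ℤ N := ∑ s ∈ Finset.univ.erase r, b.coord (Sum.inl s)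
  have hz : ∀ t, z (p t) = if t = r then 0 else 1 := by
    intro t
    simp [z, LinearMap.sum_apply, ← hb, Finsupp.single_apply]
    split_ifs <;> simp
  have hz0 : ∀ t, 0 ≤ z (p t) := fun t ↦ by rw [hz]; split_ifs <;> simp
  obtain ⟨n, hn⟩ := hO.exists_mem_dualSemigroup hz0
  -- The extra `w` forces a zero of the sum to lie in the face, even if `n = 0`.
  refine ⟨z + n • w + w, add_mem hn hO.mem_dualSemigroup, fun v ↦ ⟨fun hv ↦ ?_, ?_⟩⟩
  · obtain ⟨c, hc, hcv⟩ := mem_coneOf_singleton.1 hv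
    rw [hcv]
    have hpr := ((hface _).1 (tmul_mem_coneOf ⟨r, rfl⟩)).1
    refine ⟨smul_mem_pointedCone hc hpr, ?_⟩
    rw [map_smul, pairing_one_tmul, LinearMap.add_apply, hO.add_nsmul_apply, hO.apply_eq_zero, hz]
    simp
  · rintro ⟨hvσ, hv⟩
    rw [pairing_add, LinearMap.add_apply] at hv
    have h1 := hn v hvσ
    have h2 := hO.mem_dualSemigroup v hvσ
    have hw0 : pairing w v = 0 := by linarith
    have hz' : pairing z v = 0 := by
      have : pairing (z + n • w) v = 0 := by linarith
      rwa [pairing_add, LinearMap.add_apply, ← natCast_zsmul, pairing_smul, LinearMap.smul_apply,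
        hw0, smul_zero, add_zero] at this
    obtain ⟨c, hc, rfl⟩ := mem_coneOf_range.1 ((hface v).2 ⟨hvσ, hw0⟩)
    simp only [map_sum, map_smul, pairing_one_tmul, hz, smul_eq_mul] at hz'
    have hc0 : ∀ s, s ≠ r → c s = 0 := by
      intro s hs
      have := (Finset.sum_eq_zero_iff_of_nonneg fun s _ ↦ mul_nonneg (hc s) (by
        split_ifs <;> simp)).1 hz' s (Finset.mem_univ s)
      simpa [hs] using this
    rw [mem_coneOf_singleton]
    refine ⟨c r, hc r, Finset.sum_eq_single r (fun s _ hs ↦ ?_) (by simp)⟩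
    rw [hc0 s hs, zero_smul]

/-- A ray vector of `σ` that lies in the regular face generated by `p` is one of the `p s`. -/
theorem IsRayVector.exists_eq_of_mem [Module.Free ℤ N] {σ : PointedCone ℚ (ℚ ⊗[ℤ] N)}
    (hprim : ∀ s, IsPrimitive (p s)) (hsub : coneOf (Set.range p) ≤ σ) {q : N}
    (hq : IsRayVector σ q) (hqτ : (1 : ℚ) ⊗ₜ[ℤ] q ∈ coneOf (Set.range p)) : ∃ s, q = p s := by
  classical
  let P : Finset (ℚ ⊗[ℤ] N) := Finset.univ.image fun s ↦ (1 : ℚ) ⊗ₜ[ℤ] p s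
  have hP : PointedCone.hull ℚ (P : Set (ℚ ⊗[ℤ] N)) = coneOf (Set.range p) := by
    rw [coneOf, ← Set.range_comp]
    simp [P, Function.comp_def]
  -- The functional that cuts the ray out of `σ` also cuts it out of the face, whose generators are
  -- the `p s`.
  have hq' : IsRayVector (PointedCone.hull ℚ (P : Set (ℚ ⊗[ℤ] N))) q := by
    obtain ⟨hprim, u, hu, hface⟩ := hq
    rw [hP]
    refine ⟨hprim, u, fun v hv ↦ hu v (hsub hv), fun v ↦ ⟨fun hv ↦ ⟨?_, ((hface v).1 hv).2⟩,
      fun hv ↦ (hface v).2 ⟨hsub hv.1, hv.2⟩⟩⟩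
    obtain ⟨c, hc, rfl⟩ := mem_coneOf_singleton.1 hv
    exact smul_mem_pointedCone hc hqτ
  obtain ⟨g, hg, c, hc, hgc⟩ := hq'.exists_generator
  obtain ⟨s, -, rfl⟩ := Finset.mem_image.1 hg
  exact ⟨s, ((hprim s).eq_of_tmul_eq_smul hq.1 hc hgc).symm⟩

/-- An element of `M` that takes the value `-1` on one of the `p r`, vanishes on the others and is
nonnegative outside the face is a Demazure root. -/
theorem isDemazureRoot_of_mem_offFace [Module.Free ℤ N]
    (hray : ∀ r, IsRayVector (PointedCone.hull ℚ (G : Set (ℚ ⊗[ℤ] N))) (p r))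
    (hsub : coneOf (Set.range p) ≤ PointedCone.hull ℚ (G : Set (ℚ ⊗[ℤ] N)))
    {e : Module.Dual ℤ N} (he : e ∈ offFace G (coneOf (Set.range p))) {r : Fin k}
    (her : ∀ s, e (p s) = if r = s then -1 else 0) :
    IsDemazureRoot (PointedCone.hull ℚ (G : Set (ℚ ⊗[ℤ] N))) e := by
  refine ⟨p r, hray r, by simp [her], fun q hq hne ↦ ?_⟩
  by_cases hqτ : (1 : ℚ) ⊗ₜ[ℤ] q ∈ coneOf (Set.range p)
  · obtain ⟨s, rfl⟩ := hq.exists_eq_of_mem (fun s ↦ (hray s).1) hsub hqτ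
    rw [her, if_neg (by rintro rfl; exact hne rfl)]
  -- The ray is spanned by a generator, which like `q` lies outside the face, where `e` is
  -- nonnegative.
  · obtain ⟨g, hg, c, hc, rfl⟩ := hq.exists_generator
    have := he _ hg fun h ↦ hqτ (by
      have := smul_mem_pointedCone (inv_pos.2 hc).le h
      rwa [smul_smul, inv_mul_cancel₀ hc.ne', one_smul] at this)
    rw [map_smul, pairing_one_tmul, smul_eq_mul] at this
    exact_mod_cast nonneg_of_mul_nonneg_right this hc

end Faces
-- Laurent polynomials and the comultiplication formula.
theorem tensorMap_injective {K A A' B B' : Type*} [Field K] [CommRing A] [Algebra K A]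
    [CommRing A'] [Algebra K A'] [CommRing B] [Algebra K B] [CommRing B'] [Algebra K B']
    {f : A →ₐ[K] B} {g : A' →ₐ[K] B'} (hf : Function.Injective f) (hg : Function.Injective g) :
    Function.Injective (Algebra.TensorProduct.map f g) :=
  TensorProduct.map_injective_of_flat_flat f.toLinearMap g.toLinearMap hf hg

section Laurent

variable (K : Type u) [Field K] {N : Type u} [AddCommGroup N]

theorem chi_zero : chi K (0 : Module.Dual ℤ N) = 1 := rfl

theorem chi_add (u v : Module.Dual ℤ N) : chi K (u + v) = chi K u * chi K v := by
  simp [chi, AddMonoidAlgebra.single_mul_single]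

theorem chi_nsmul (n : ℕ) (u : Module.Dual ℤ N) : chi K (n • u) = chi K u ^ n := by
  simp [chi, AddMonoidAlgebra.single_pow]

theorem chi_sum {I : Type*} (s : Finset I) (u : I → Module.Dual ℤ N) :
    chi K (∑ i ∈ s, u i) = ∏ i ∈ s, chi K (u i) := by
  classical
  induction s using Finset.induction_on with
  | empty => simp [chi_zero]
  | insert i s hi ih => rw [Finset.sum_insert hi, Finset.prod_insert hi, chi_add, ih]

theorem toLaurent_single (σ : PointedCone ℚ (ℚ ⊗[ℤ] N)) (u : dualSemigroup σ) :
    toLaurent K σ (AddMonoidAlgebra.single u 1) = chi K (u : Module.Dual ℤ N) := by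
  simp [toLaurent, chi]

theorem toLaurent_injective (σ : PointedCone ℚ (ℚ ⊗[ℤ] N)) :
    Function.Injective (toLaurent K σ) :=
  AddMonoidAlgebra.mapDomain_injective Subtype.val_injective

variable {K}

theorem ToricRing.algHom_ext {σ : PointedCone ℚ (ℚ ⊗[ℤ] N)} {B : Type*} [Semiring B] [Algebra K B]
    {f g : ToricRing K σ →ₐ[K] B}
    (h : ∀ u, f (AddMonoidAlgebra.single u 1) = g (AddMonoidAlgebra.single u 1)) : f = g :=
  AddMonoidAlgebra.algHom_ext h (Subsingleton.elim _ _)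

end Laurent

section Comul

variable (K : Type u) [Field K] {N : Type u} [AddCommGroup N] {k : ℕ}
  (σ : PointedCone ℚ (ℚ ⊗[ℤ] N)) (p : Fin k → N) (e₁ e₂ : Fin k → Module.Dual ℤ N)

/-- The factor `1 ⊗ χ^{e₁⁽ʳ⁾} + χ^{e₂⁽ʳ⁾} ⊗ 1` of the comultiplication of a root monoid. -/
def rootFactor (r : Fin k) :
    AddMonoidAlgebra K (Module.Dual ℤ N) ⊗[K] AddMonoidAlgebra K (Module.Dual ℤ N) :=
  1 ⊗ₜ[K] chi K (e₁ r) + chi K (e₂ r) ⊗ₜ[K] 1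

variable {K σ p e₁ e₂} {O : AddSubmonoid (Module.Dual ℤ N)} {w : Module.Dual ℤ N}

theorem chi_tmul_chi_mem_range (hO : IsRegularFaceData σ p O w) {a b : Module.Dual ℤ N}
    (ha : a ∈ O) (ha' : ∀ s, 0 ≤ a (p s)) (hb : b ∈ O) (hb' : ∀ s, 0 ≤ b (p s)) :
    chi K a ⊗ₜ[K] chi K b ∈
      (Algebra.TensorProduct.map (toLaurent K σ) (toLaurent K σ)).range := by
  refine ⟨AddMonoidAlgebra.single ⟨a, (hO.mem_dual_iff a).2 ⟨ha, ha'⟩⟩ 1 ⊗ₜ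
    AddMonoidAlgebra.single ⟨b, (hO.mem_dual_iff b).2 ⟨hb, hb'⟩⟩ 1, ?_⟩
  refine (Algebra.TensorProduct.map_tmul _ _ _ _).trans ?_
  rw [toLaurent_single, toLaurent_single]

/-- In the binomial expansion of the factor `t`, the term with index `j` lowers the value at `p t`
by `n t - j` in the left exponent and by `j` in the right one. Neither exceeds `n t`, and values at
the other `p s` do not change. Thus `T` records the factors still to be expanded, with a reserve of
`n s` at each of them. -/
theorem chi_tmul_chi_mul_prod_mem_range (hO : IsRegularFaceData σ p O w)
    (h₁ : ∀ r s, e₁ r (p s) = if r = s then -1 else 0)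
    (h₂ : ∀ r s, e₂ r (p s) = if r = s then -1 else 0)
    (m₁ : ∀ r, e₁ r ∈ O) (m₂ : ∀ r, e₂ r ∈ O) (n : Fin k → ℕ) (T : Finset (Fin k))
    {a b : Module.Dual ℤ N} (ha : a ∈ O) (ha' : ∀ s, (if s ∈ T then (n s : ℤ) else 0) ≤ a (p s))
    (hb : b ∈ O) (hb' : ∀ s, (if s ∈ T then (n s : ℤ) else 0) ≤ b (p s)) :
    (chi K a ⊗ₜ[K] chi K b) * ∏ r ∈ T, rootFactor K e₁ e₂ r ^ n r ∈
      (Algebra.TensorProduct.map (toLaurent K σ) (toLaurent K σ)).range := by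
  induction T using Finset.induction_on generalizing a b with
  | empty =>
    rw [Finset.prod_empty, mul_one]
    exact chi_tmul_chi_mem_range hO ha (by simpa using ha') hb (by simpa using hb')
  | insert t T ht ih =>
    rw [Finset.prod_insert ht, ← mul_assoc, rootFactor, add_pow, Finset.mul_sum, Finset.sum_mul]
    refine sum_mem fun j hj ↦ ?_
    have hjn : j ≤ n t := Nat.lt_succ_iff.1 (Finset.mem_range.1 hj)
    have hpow : (chi K (e₂ t) ^ (n t - j)) ⊗ₜ[K] (chi K (e₁ t) ^ j) =
        ((1 : AddMonoidAlgebra K (Module.Dual ℤ N)) ⊗ₜ[K] chi K (e₁ t)) ^ j *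
          (chi K (e₂ t) ⊗ₜ[K] (1 : AddMonoidAlgebra K (Module.Dual ℤ N))) ^ (n t - j) := by
      rw [Algebra.TensorProduct.tmul_pow, Algebra.TensorProduct.tmul_pow, one_pow, one_pow,
        Algebra.TensorProduct.tmul_mul_tmul, one_mul, mul_one]
    have key : (n t).choose j • ((chi K (a + (n t - j) • e₂ t) ⊗ₜ[K] chi K (b + j • e₁ t)) *
          ∏ r ∈ T, rootFactor K e₁ e₂ r ^ n r) =
        chi K a ⊗ₜ[K] chi K b * (((1 : AddMonoidAlgebra K (Module.Dual ℤ N)) ⊗ₜ[K]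
          chi K (e₁ t)) ^ j * (chi K (e₂ t) ⊗ₜ[K] (1 : AddMonoidAlgebra K (Module.Dual ℤ N))) ^
            (n t - j) * ((n t).choose j :
              AddMonoidAlgebra K (Module.Dual ℤ N) ⊗[K] AddMonoidAlgebra K (Module.Dual ℤ N))) *
          ∏ r ∈ T, rootFactor K e₁ e₂ r ^ n r := by
        rw [chi_add, chi_add, chi_nsmul, chi_nsmul, ← Algebra.TensorProduct.tmul_mul_tmul, hpow,
          nsmul_eq_mul]
        ring
    rw [← key]
    refine nsmul_mem (ih (add_mem ha (nsmul_mem (m₂ t) _)) ?_ (add_mem hb (nsmul_mem (m₁ t) _)) ?_) _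
    · intro s
      have := ha' s
      simp only [LinearMap.add_apply, LinearMap.smul_apply, h₂, Finset.mem_insert] at this ⊢
      by_cases hst : t = s
      · subst hst
        simp [ht] at this ⊢
        omega
      · simpa [hst, Ne.symm hst] using this
    · intro s
      have := hb' s
      simp only [LinearMap.add_apply, LinearMap.smul_apply, h₁, Finset.mem_insert] at this ⊢
      by_cases hst : t = s
      · subst hst
        simp [ht] at this ⊢
        omega
      · simpa [hst, Ne.symm hst] using this

variable (K e₁ e₂) in
/-- The comultiplication of a root monoid, with values in `K[M] ⊗ K[M]`. -/
def laurentComul (hO : IsRegularFaceData σ p O w) : ToricRing K σ →ₐ[K]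
    AddMonoidAlgebra K (Module.Dual ℤ N) ⊗[K] AddMonoidAlgebra K (Module.Dual ℤ N) :=
  AddMonoidAlgebra.lift K _ (dualSemigroup σ)
    { toFun := fun u ↦ (chi K (u.toAdd : Module.Dual ℤ N) ⊗ₜ[K] chi K (u.toAdd : Module.Dual ℤ N)) *
        ∏ r, rootFactor K e₁ e₂ r ^ ((u.toAdd : Module.Dual ℤ N) (p r)).toNat
      map_one' := by simp [chi_zero, Algebra.TensorProduct.one_def]
      map_mul' := fun u v ↦ by
        have hu := ((hO.mem_dual_iff _).1 u.toAdd.2).2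
        have hv := ((hO.mem_dual_iff _).1 v.toAdd.2).2
        simp only [toAdd_mul, AddSubmonoid.coe_add, LinearMap.add_apply, chi_add,
          Int.toNat_add (hu _) (hv _), pow_add, Finset.prod_mul_distrib,
          ← Algebra.TensorProduct.tmul_mul_tmul]
        ring }

theorem laurentComul_single (hO : IsRegularFaceData σ p O w) (u : dualSemigroup σ) :
    laurentComul K e₁ e₂ hO (AddMonoidAlgebra.single u 1) =
      (chi K (u : Module.Dual ℤ N) ⊗ₜ[K] chi K (u : Module.Dual ℤ N)) *
        ∏ r, rootFactor K e₁ e₂ r ^ ((u : Module.Dual ℤ N) (p r)).toNat := by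
  simp [laurentComul]

/-- The roots are not in `S_σ`, so the factors make sense only in `K[M] ⊗ K[M]`; the full product
returns to `K[S_σ] ⊗ K[S_σ]`, which embeds there since `K` is a field. -/
theorem exists_comul (hO : IsRegularFaceData σ p O w)
    (h₁ : ∀ r s, e₁ r (p s) = if r = s then -1 else 0)
    (h₂ : ∀ r s, e₂ r (p s) = if r = s then -1 else 0)
    (m₁ : ∀ r, e₁ r ∈ O) (m₂ : ∀ r, e₂ r ∈ O) :
    ∃ Δ : ToricRing K σ →ₐ[K] ToricRing K σ ⊗[K] ToricRing K σ,
      (Algebra.TensorProduct.map (toLaurent K σ) (toLaurent K σ)).comp Δ =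
        laurentComul K e₁ e₂ hO := by
  let E := AlgEquiv.ofInjective (Algebra.TensorProduct.map (toLaurent K σ) (toLaurent K σ))
    (tensorMap_injective (toLaurent_injective K σ) (toLaurent_injective K σ))
  have hmem : ∀ x, laurentComul K e₁ e₂ hO x ∈
      (Algebra.TensorProduct.map (toLaurent K σ) (toLaurent K σ)).range := by
    intro x
    induction x using AddMonoidAlgebra.induction_linear with
    | zero => rw [map_zero]; exact zero_mem _
    | add f g hf hg => rw [map_add]; exact add_mem hf hg
    | single u c =>
      have : AddMonoidAlgebra.single u c = c • (AddMonoidAlgebra.single u 1 : ToricRing K σ) := by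
        simp
      rw [this, map_smul, laurentComul_single]
      obtain ⟨hu, hu'⟩ := (hO.mem_dual_iff _).1 u.2
      exact Subalgebra.smul_mem _ (chi_tmul_chi_mul_prod_mem_range hO h₁ h₂ m₁ m₂ _ _ hu
        (fun s ↦ by simp [hu' s]) hu (fun s ↦ by simp [hu' s])) c
  refine ⟨E.symm.toAlgHom.comp ((laurentComul K e₁ e₂ hO).codRestrict _ hmem), ?_⟩
  refine AlgHom.ext fun x ↦ ?_
  exact congrArg Subtype.val (E.apply_symm_apply ⟨laurentComul K e₁ e₂ hO x, hmem x⟩)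

end Comul
-- The open chart `G_χ → X_σ` on coordinate rings.
open SemidirectRing

section Chart

variable (K : Type u) [Field K] {N : Type u} [AddCommGroup N] {k : ℕ}
  {σ : PointedCone ℚ (ℚ ⊗[ℤ] N)} {p : Fin k → N} {e₁ e₂ : Fin k → Module.Dual ℤ N}
  {O : AddSubmonoid (Module.Dual ℤ N)} {w : Module.Dual ℤ N}
  {L : Type u} [AddCommGroup L] (χ : Fin k → L) (φ : L ≃ₗ[ℤ] perp (coneOf (Set.range p)))

theorem SemidirectRing.char_nsmul (n : ℕ) (l : L) : char K χ (n • l) = char K χ l ^ n := by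
  induction n with
  | zero => simp [char_zero]
  | succ n ih => rw [succ_nsmul, char_add, ih, pow_succ]

theorem SemidirectRing.isUnit_char (l : L) : IsUnit (char K χ l) :=
  IsUnit.of_mul_eq_one _ (char_mul_neg K χ l)

/-- A subalgebra of the coordinate ring of `G_χ` that contains the characters and the coordinates
is the whole ring. -/
theorem SemidirectRing.eq_top_of_mem {S : Subalgebra K (SemidirectRing K χ)}
    (hchar : ∀ l, char K χ l ∈ S) (hcoord : ∀ r, coord K χ r ∈ S) : S = ⊤ := by
  let f : SemidirectRing K χ →ₐ[K] S := SemidirectRing.lift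
    { toFun := fun l ↦ ⟨char K χ l.toAdd, hchar _⟩
      map_one' := Subtype.ext (char_zero K χ)
      map_mul' := fun l l' ↦ Subtype.ext (char_add K χ _ _) }
    (fun r ↦ ⟨coord K χ r, hcoord r⟩)
  have hf : S.val.comp f = AlgHom.id K _ := by
    apply SemidirectRing.algHom_ext
    · intro l
      exact congrArg Subtype.val (lift_char _ _ l)
    · intro r
      exact congrArg Subtype.val (lift_coord _ _ r)
  refine eq_top_iff.2 fun x _ ↦ ?_
  have hx : (f x : SemidirectRing K χ) = x := DFunLike.congr_fun hf x
  exact hx ▸ (f x).2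

/-- The projection `u ↦ u + ∑ ⟨p_r, u⟩ e₁⁽ʳ⁾` of `M` onto `τ^⊥ ∩ M`. -/
def perpProj (h₁ : ∀ r s, e₁ r (p s) = if r = s then -1 else 0) :
    Module.Dual ℤ N →+ perp (coneOf (Set.range p)) where
  toFun u := ⟨u + ∑ r, u (p r) • e₁ r, mem_perp_coneOf_range.2 fun s ↦ by
    simp [LinearMap.sum_apply, h₁]⟩
  map_zero' := Subtype.ext (by simp)
  map_add' u v := Subtype.ext (by
    simp only [LinearMap.add_apply, add_smul, Finset.sum_add_distrib, Submodule.coe_add]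
    abel)

theorem coe_perpProj (h₁ : ∀ r s, e₁ r (p s) = if r = s then -1 else 0) (u : Module.Dual ℤ N) :
    (perpProj h₁ u : Module.Dual ℤ N) = u + ∑ r, u (p r) • e₁ r := rfl

/-- The dual of the open embedding `G_χ → X_σ`:
`χ^u ↦ φ⁻¹(u + ∑ ⟨p_r, u⟩ e₁⁽ʳ⁾) ∏ α_r ^ ⟨p_r, u⟩`. -/
def chart (hO : IsRegularFaceData σ p O w)
    (h₁ : ∀ r s, e₁ r (p s) = if r = s then -1 else 0) : ToricRing K σ →ₐ[K] SemidirectRing K χ :=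
  AddMonoidAlgebra.lift K _ (dualSemigroup σ)
    { toFun := fun u ↦ char K χ (φ.symm (perpProj h₁ (u.toAdd : Module.Dual ℤ N))) *
        ∏ r, coord K χ r ^ ((u.toAdd : Module.Dual ℤ N) (p r)).toNat
      map_one' := by simp [char_zero]
      map_mul' := fun u v ↦ by
        have hu := ((hO.mem_dual_iff _).1 u.toAdd.2).2
        have hv := ((hO.mem_dual_iff _).1 v.toAdd.2).2
        simp only [toAdd_mul, AddSubmonoid.coe_add, map_add, LinearMap.add_apply, char_add,
          Int.toNat_add (hu _) (hv _), pow_add, Finset.prod_mul_distrib]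
        ring }

theorem chart_single (hO : IsRegularFaceData σ p O w)
    (h₁ : ∀ r s, e₁ r (p s) = if r = s then -1 else 0) (u : dualSemigroup σ) :
    chart K χ φ hO h₁ (AddMonoidAlgebra.single u 1) =
      char K χ (φ.symm (perpProj h₁ (u : Module.Dual ℤ N))) *
        ∏ r, coord K χ r ^ ((u : Module.Dual ℤ N) (p r)).toNat := by
  simp [chart]

variable (e₁) in
/-- The inclusion of the coordinate ring of `G_χ` into `K[M]`: `l ↦ χ^{φ l}`,
`α_r ↦ χ^{-e₁⁽ʳ⁾}`. -/
def laurentChart : SemidirectRing K χ →ₐ[K] AddMonoidAlgebra K (Module.Dual ℤ N) :=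
  SemidirectRing.lift
    { toFun := fun l ↦ chi K (φ l.toAdd : Module.Dual ℤ N)
      map_one' := by simp [chi_zero]
      map_mul' := by simp [chi_add] }
    (fun r ↦ chi K (-e₁ r))

theorem laurentChart_char (l : L) :
    laurentChart K e₁ χ φ (char K χ l) = chi K (φ l : Module.Dual ℤ N) :=
  lift_char _ _ _

theorem laurentChart_coord (r : Fin k) :
    laurentChart K e₁ χ φ (coord K χ r) = chi K (-e₁ r) :=
  lift_coord _ _ _

/-- The multiples of `e₁⁽ʳ⁾` added by the projection to `τ^⊥` cancel against the powers of `α_r =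
χ^{-e₁⁽ʳ⁾}`. Identities in the chart can thus be checked in `K[M]`. -/
theorem laurentChart_comp_chart (hO : IsRegularFaceData σ p O w)
    (h₁ : ∀ r s, e₁ r (p s) = if r = s then -1 else 0) :
    (laurentChart K e₁ χ φ).comp (chart K χ φ hO h₁) = toLaurent K σ := by
  apply ToricRing.algHom_ext
  intro u
  have hu := ((hO.mem_dual_iff _).1 u.2).2
  rw [AlgHom.comp_apply, chart_single, map_mul, map_prod, laurentChart_char, toLaurent_single,
    LinearEquiv.apply_symm_apply, coe_perpProj]
  simp only [map_pow, laurentChart_coord, ← chi_nsmul, ← chi_sum, ← chi_add]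
  congr 1
  rw [add_assoc, ← Finset.sum_add_distrib]
  convert! add_zero _
  refine Finset.sum_eq_zero fun r _ ↦ ?_
  rw [← natCast_zsmul, Int.toNat_of_nonneg (hu r), smul_neg, add_neg_cancel]

theorem chart_injective (hO : IsRegularFaceData σ p O w)
    (h₁ : ∀ r s, e₁ r (p s) = if r = s then -1 else 0) :
    Function.Injective (chart K χ φ hO h₁) := by
  have := toLaurent_injective K σ
  rw [← laurentChart_comp_chart K χ φ hO h₁, AlgHom.coe_comp] at this
  exact this.of_comp

theorem chart_single_of_apply_eq_zero (hO : IsRegularFaceData σ p O w)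
    (h₁ : ∀ r s, e₁ r (p s) = if r = s then -1 else 0) {u : dualSemigroup σ}
    (hu : ∀ s, (u : Module.Dual ℤ N) (p s) = 0) {l : L}
    (hl : (φ l : Module.Dual ℤ N) = u) :
    chart K χ φ hO h₁ (AddMonoidAlgebra.single u 1) = char K χ l := by
  have : perpProj h₁ (u : Module.Dual ℤ N) = φ l := Subtype.ext (by
    rw [coe_perpProj, hl]
    simp [hu])
  rw [chart_single, this, LinearEquiv.symm_apply_apply]
  simp [hu]

/-- The function `χ^w` on `X_σ` whose nonvanishing locus is the chart of the regular face. -/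
def supportFunction (hO : IsRegularFaceData σ p O w) : ToricRing K σ :=
  AddMonoidAlgebra.single ⟨w, hO.mem_dualSemigroup⟩ 1

/-- The character of the torus that corresponds to `w ∈ τ^⊥ ∩ M`. -/
def supportCharacter (hO : IsRegularFaceData σ p O w) : L :=
  φ.symm ⟨w, mem_perp_coneOf_range.2 hO.apply_eq_zero⟩

theorem chart_supportFunction (hO : IsRegularFaceData σ p O w)
    (h₁ : ∀ r s, e₁ r (p s) = if r = s then -1 else 0) :
    chart K χ φ hO h₁ (supportFunction K hO) = char K χ (supportCharacter φ hO) :=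
  chart_single_of_apply_eq_zero K χ φ hO h₁ hO.apply_eq_zero (by simp [supportCharacter])

/-- The elements with this property form a subalgebra, so characters and coordinates suffice. They
correspond to `χ^{φ l}` and `χ^{-e₁⁽ʳ⁾}`, whose exponents are nonnegative on the face and enter
`S_σ` after adding a multiple of `w`. -/
theorem exists_chart_eq (hO : IsRegularFaceData σ p O w)
    (h₁ : ∀ r s, e₁ r (p s) = if r = s then -1 else 0) (x : SemidirectRing K χ) :
    ∃ (n : ℕ) (a : ToricRing K σ),
      x * char K χ (supportCharacter φ hO) ^ n = chart K χ φ hO h₁ a := by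
  let S : Subalgebra K (SemidirectRing K χ) :=
    { carrier := {x | ∃ (n : ℕ) (a : ToricRing K σ),
        x * char K χ (supportCharacter φ hO) ^ n = chart K χ φ hO h₁ a}
      mul_mem' := by
        rintro x y ⟨m, a, hx⟩ ⟨n, b, hy⟩
        refine ⟨m + n, a * b, ?_⟩
        rw [map_mul, ← hx, ← hy, pow_add]
        ring
      add_mem' := by
        rintro x y ⟨m, a, hx⟩ ⟨n, b, hy⟩
        refine ⟨m + n, a * supportFunction K hO ^ n + b * supportFunction K hO ^ m, ?_⟩
        rw [map_add, map_mul, map_mul, map_pow, map_pow, ← hx, ← hy, chart_supportFunction, pow_add]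
        ring
      algebraMap_mem' := fun c ↦ ⟨0, algebraMap K _ c, by rw [AlgHom.commutes, pow_zero, mul_one]⟩ }
  have hS : S = ⊤ := by
    apply SemidirectRing.eq_top_of_mem
    · intro l
      have hl := mem_perp_coneOf_range.1 (φ l).2
      obtain ⟨n, hn⟩ := hO.exists_mem_dualSemigroup (u := φ l) fun s ↦ (hl s).ge
      refine ⟨n, AddMonoidAlgebra.single ⟨_, hn⟩ 1, ?_⟩
      rw [← SemidirectRing.char_nsmul, ← char_add]
      refine (chart_single_of_apply_eq_zero K χ φ hO h₁ (fun s ↦ ?_) ?_).symm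
      · rw [hO.add_nsmul_apply, hl]
      · simp [supportCharacter]
    · intro r
      have hr : ∀ s, (-e₁ r) (p s) = if r = s then 1 else 0 := fun s ↦ by
        rw [LinearMap.neg_apply, h₁]
        split_ifs <;> simp
      obtain ⟨n, hn⟩ := hO.exists_mem_dualSemigroup (u := -e₁ r) fun s ↦ by
        rw [hr]
        split_ifs <;> simp
      refine ⟨n, AddMonoidAlgebra.single ⟨_, hn⟩ 1, ?_⟩
      have hproj : perpProj h₁ (-e₁ r + n • w) = φ (n • supportCharacter φ hO) := Subtype.ext (by
        rw [coe_perpProj]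
        simp only [hO.add_nsmul_apply, hr]
        simp [supportCharacter])
      rw [chart_single, hproj, LinearEquiv.symm_apply_apply, SemidirectRing.char_nsmul, mul_comm]
      simp only [hO.add_nsmul_apply, hr]
      rw [Finset.prod_eq_single r (fun s _ hs ↦ by simp [Ne.symm hs]) (by simp)]
      simp
  have hx : x ∈ S := hS ▸ Algebra.mem_top
  exact hx

theorem isLocalization_chart (hO : IsRegularFaceData σ p O w)
    (h₁ : ∀ r s, e₁ r (p s) = if r = s then -1 else 0) :
    letI := (chart K χ φ hO h₁).toRingHom.toAlgebra
    IsLocalization.Away (supportFunction K hO) (SemidirectRing K χ) := by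
  let := (chart K χ φ hO h₁).toRingHom.toAlgebra
  have hw : algebraMap (ToricRing K σ) (SemidirectRing K χ) (supportFunction K hO) =
      char K χ (supportCharacter φ hO) := chart_supportFunction K χ φ hO h₁
  refine IsLocalization.Away.mk _ ?_ ?_ ?_
  · rw [hw]
    exact SemidirectRing.isUnit_char K χ _
  · intro x
    rw [hw]
    exact exists_chart_eq K χ φ hO h₁ x
  · intro a b hab
    exact ⟨0, by rw [chart_injective K χ φ hO h₁ hab]⟩

/-- Multiplying by a power of the unit belonging to `w` moves an element of the kernel into
`K[S_σ]`, where the map is the inclusion into `K[M]`. -/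
theorem laurentChart_injective (hO : IsRegularFaceData σ p O w)
    (h₁ : ∀ r s, e₁ r (p s) = if r = s then -1 else 0) :
    Function.Injective (laurentChart K e₁ χ φ) := by
  rw [injective_iff_map_eq_zero]
  intro x hx
  obtain ⟨n, a, ha⟩ := exists_chart_eq K χ φ hO h₁ x
  have h0 : toLaurent K σ a = 0 := by
    rw [← laurentChart_comp_chart K χ φ hO h₁, AlgHom.comp_apply, ← ha, map_mul, hx, zero_mul]
  rw [(map_eq_zero_iff _ (toLaurent_injective K σ)).1 h0, map_zero] at ha
  exact (((SemidirectRing.isUnit_char K χ _).pow n).mul_left_eq_zero).1 ha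

/-- The chart is compatible with the comultiplications. -/
theorem map_chart_comp_comul (hO : IsRegularFaceData σ p O w)
    (h₁ : ∀ r s, e₁ r (p s) = if r = s then -1 else 0)
    (hφ : ∀ r, e₂ r - e₁ r = φ (χ r))
    {Δ : ToricRing K σ →ₐ[K] ToricRing K σ ⊗[K] ToricRing K σ}
    (hΔ : (Algebra.TensorProduct.map (toLaurent K σ) (toLaurent K σ)).comp Δ =
      laurentComul K e₁ e₂ hO) :
    (Algebra.TensorProduct.map (chart K χ φ hO h₁) (chart K χ φ hO h₁)).comp Δ =
      (comulHom K χ).comp (chart K χ φ hO h₁) := by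
  have hinj := tensorMap_injective (laurentChart_injective K χ φ hO h₁)
    (laurentChart_injective K χ φ hO h₁)
  rw [← AlgHom.cancel_left hinj, ← AlgHom.comp_assoc, ← Algebra.TensorProduct.map_comp,
    laurentChart_comp_chart, hΔ]
  apply ToricRing.algHom_ext
  intro u
  have hu := ((hO.mem_dual_iff _).1 u.2).2
  -- The prescribed difference `e₂ - e₁ = φ(χ_r)` turns the root factor into the group law of `G_χ`,
  -- up to a monomial that `hproj` absorbs.
  have hfac : ∀ r, rootFactor K e₁ e₂ r = (chi K (e₁ r) ⊗ₜ[K] chi K (e₁ r)) *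
      Algebra.TensorProduct.map (laurentChart K e₁ χ φ) (laurentChart K e₁ χ φ)
        (comulHom K χ (coord K χ r)) := by
    intro r
    rw [comulHom_coord, map_add, Algebra.TensorProduct.map_tmul, Algebra.TensorProduct.map_tmul,
      laurentChart_coord, laurentChart_char, ← hφ, map_one, mul_add,
      Algebra.TensorProduct.tmul_mul_tmul, Algebra.TensorProduct.tmul_mul_tmul, ← chi_add,
      ← chi_add, add_neg_cancel, add_sub_cancel, chi_zero, mul_one, rootFactor]
  have hproj : chi K (φ (φ.symm (perpProj h₁ (u : Module.Dual ℤ N))) : Module.Dual ℤ N) =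
      chi K (u : Module.Dual ℤ N) *
        ∏ r, chi K (e₁ r) ^ ((u : Module.Dual ℤ N) (p r)).toNat := by
    simp only [← chi_nsmul, ← chi_sum, ← chi_add]
    rw [LinearEquiv.apply_symm_apply, coe_perpProj]
    congr 2
    refine Finset.sum_congr rfl fun r _ ↦ ?_
    rw [← natCast_zsmul, Int.toNat_of_nonneg (hu r)]
  have hprod : ∀ f : Fin k → AddMonoidAlgebra K (Module.Dual ℤ N),
      (∏ r, f r) ⊗ₜ[K] (∏ r, f r) = ∏ r, (f r ⊗ₜ[K] f r) := fun f ↦ by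
    induction (Finset.univ : Finset (Fin k)) using Finset.induction_on with
    | empty => simp [Algebra.TensorProduct.one_def]
    | insert i s hi ih =>
      rw [Finset.prod_insert hi, Finset.prod_insert hi, ← Algebra.TensorProduct.tmul_mul_tmul, ih]
  rw [laurentComul_single, AlgHom.comp_apply, AlgHom.comp_apply, chart_single, map_mul, map_mul,
    map_prod, map_prod, comulHom_char, Algebra.TensorProduct.map_tmul, laurentChart_char, hproj,
    ← Algebra.TensorProduct.tmul_mul_tmul, hprod, mul_assoc, ← Finset.prod_mul_distrib]
  congr 1
  refine Finset.prod_congr rfl fun r _ ↦ ?_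
  rw [hfac, mul_pow, map_pow, map_pow, Algebra.TensorProduct.tmul_pow]

end Chart
-- Bialgebra structures inherited by subalgebras.
section Bialgebra

variable {K A H : Type*} [Field K] [CommRing A] [Algebra K A] [CommRing H]

/-- The bialgebra structure on a subalgebra of a bialgebra that is closed under the
comultiplication. -/
abbrev bialgebraOfInjective [Bialgebra K H] (f : A →ₐ[K] H) (hf : Function.Injective f)
    (Δ : A →ₐ[K] A ⊗[K] A)
    (hΔ : (Algebra.TensorProduct.map f f).comp Δ = (Bialgebra.comulAlgHom K H).comp f) :
    Bialgebra K A :=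
  Bialgebra.ofAlgHom Δ ((Bialgebra.counitAlgHom K H).comp f)
    (by
      -- Each axiom is checked after applying an injective tensor product of maps, where it becomes
      -- the axiom of `H` composed with `f`.
      have hinj := tensorMap_injective hf (tensorMap_injective hf hf)
      rw [← AlgHom.cancel_left hinj]
      have hH : (Algebra.TensorProduct.assoc K K K H H H).toAlgHom.comp
          ((Algebra.TensorProduct.map (Bialgebra.comulAlgHom K H) (.id K H)).comp
            (Bialgebra.comulAlgHom K H)) =
          (Algebra.TensorProduct.map (.id K H) (Bialgebra.comulAlgHom K H)).comp
            (Bialgebra.comulAlgHom K H) :=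
        AlgHom.ext fun x ↦ Coalgebra.coassoc_apply x
      have hassoc : (Algebra.TensorProduct.map f (Algebra.TensorProduct.map f f)).comp
          (Algebra.TensorProduct.assoc K K K A A A).toAlgHom =
          (Algebra.TensorProduct.assoc K K K H H H).toAlgHom.comp
            (Algebra.TensorProduct.map (Algebra.TensorProduct.map f f) f) := by
        ext <;> simp [Algebra.TensorProduct.one_def]
      calc _ = (Algebra.TensorProduct.assoc K K K H H H).toAlgHom.comp
            ((Algebra.TensorProduct.map ((Algebra.TensorProduct.map f f).comp Δ)
              (f.comp (.id K A))).comp Δ) := by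
            rw [← AlgHom.comp_assoc, hassoc, Algebra.TensorProduct.map_comp]
            rfl
        _ = ((Algebra.TensorProduct.assoc K K K H H H).toAlgHom.comp
            ((Algebra.TensorProduct.map (Bialgebra.comulAlgHom K H) (.id K H)).comp
              (Bialgebra.comulAlgHom K H))).comp f := by
            rw [hΔ, AlgHom.comp_id, ← AlgHom.id_comp f, Algebra.TensorProduct.map_comp,
              AlgHom.id_comp, AlgHom.comp_assoc, hΔ]
            rfl
        _ = (Algebra.TensorProduct.map (f.comp (.id K A))
            ((Algebra.TensorProduct.map f f).comp Δ)).comp Δ := by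
            rw [hH, hΔ, AlgHom.comp_id, AlgHom.comp_assoc, ← hΔ, ← AlgHom.comp_assoc,
              ← Algebra.TensorProduct.map_comp, AlgHom.id_comp, hΔ]
        _ = _ := by
            rw [Algebra.TensorProduct.map_comp, AlgHom.comp_assoc])
    (by
      have hinj := tensorMap_injective (AlgHom.id K K).injective hf
      rw [← AlgHom.cancel_left hinj, ← AlgHom.comp_assoc, ← Algebra.TensorProduct.map_comp]
      have hH : (Algebra.TensorProduct.map (Bialgebra.counitAlgHom K H) (.id K H)).comp
          (Bialgebra.comulAlgHom K H) = (Algebra.TensorProduct.lid K H).symm :=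
        AlgHom.ext fun x ↦ Coalgebra.rTensor_counit_comul x
      calc _ = ((Algebra.TensorProduct.map (Bialgebra.counitAlgHom K H) (.id K H)).comp
            (Algebra.TensorProduct.map f f)).comp Δ := by
            rw [← Algebra.TensorProduct.map_comp]
            rfl
        _ = _ := by
            rw [AlgHom.comp_assoc, hΔ, ← AlgHom.comp_assoc, hH]
            ext x
            simp)
    (by
      have hinj := tensorMap_injective hf (AlgHom.id K K).injective
      rw [← AlgHom.cancel_left hinj, ← AlgHom.comp_assoc, ← Algebra.TensorProduct.map_comp]
      have hH : (Algebra.TensorProduct.map (.id K H) (Bialgebra.counitAlgHom K H)).comp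
          (Bialgebra.comulAlgHom K H) = (Algebra.TensorProduct.rid K K H).symm :=
        AlgHom.ext fun x ↦ Coalgebra.lTensor_counit_comul x
      calc _ = ((Algebra.TensorProduct.map (.id K H) (Bialgebra.counitAlgHom K H)).comp
            (Algebra.TensorProduct.map f f)).comp Δ := by
            rw [← Algebra.TensorProduct.map_comp]
            rfl
        _ = _ := by
            rw [AlgHom.comp_assoc, hΔ, ← AlgHom.comp_assoc, hH]
            ext x
            simp)

end Bialgebra

/-! ### Affine monoid schemes and their invertible points. -/

section Spec

variable {K A H : Type u} [Field K] [CommRing A] [CommRing H] [Bialgebra K A] [HopfAlgebra K H]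

/-- The morphism of affine monoid schemes that is dual to a homomorphism of bialgebras. -/
def specHom (f : A →ₐc[K] H) :
    (Spec (.of H)).asOver (Spec (.of K)) ⟶ (Spec (.of A)).asOver (Spec (.of K)) :=
  ((bialgSpec (.of K)).map (.op (CommBialgCat.ofHom f))).hom

theorem isMonHom_specHom (f : A →ₐc[K] H) : IsMonHom (specHom f) :=
  ((bialgSpec (.of K)).map (.op (CommBialgCat.ofHom f))).isMonHom_hom

theorem specHom_left (f : A →ₐc[K] H) :
    (specHom f).left = Spec.map (CommRingCat.ofHom (f : A →ₐ[K] H).toRingHom) := rfl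

/-- Evaluation at a group-like element turns convolution into multiplication in `K`. -/
theorem isUnit_apply_of_isUnit {w : A} (hw : IsGroupLikeElem K w) {a : WithConv (A →ₐ[K] K)}
    (ha : IsUnit a) : IsUnit (a.ofConv w) := by
  obtain ⟨b, hb⟩ := ha.exists_right_inv
  have := congrArg (fun c : WithConv (A →ₐ[K] K) ↦ c.ofConv w) hb
  refine IsUnit.of_mul_eq_one (b.ofConv w) ?_
  simpa [AlgHom.convMul_def, AlgHom.convOne_def, hw.counit_eq_one, hw.comul_eq_tmul_self] using this

variable (K) in
/-- The terminal object of the category of schemes over `K`, as a spectrum. -/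
def terminalIsoSpec :
    𝟙_ (Over (Spec (.of K))) ≅ (Spec (.of K)).asOver (Spec (.of K)) :=
  Over.isoMk (Iso.refl (Spec (.of K))) (by
    change 𝟙 _ ≫ Spec.map (CommRingCat.ofHom (algebraMap K K)) = 𝟙 _
    rw [Category.id_comp]
    exact Spec.map_id _)

theorem isUnitGroup_specHom (f : A →ₐc[K] H) {w : A} (hw : IsGroupLikeElem K w)
    (hloc : letI := (f : A →ₐ[K] H).toRingHom.toAlgebra; IsLocalization.Away w H) :
    IsUnitGroup (specHom f) where
  isMonHom := isMonHom_specHom f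
  isOpenImmersion := by
    let := (f : A →ₐ[K] H).toRingHom.toAlgebra
    rw [specHom_left]
    exact IsOpenImmersion.of_isLocalization w
  isUnit_iff x := by
    constructor
    · intro hx
      -- This translates the point `x` multiplicatively into an algebra homomorphism `A → K`; being
      -- invertible, it sends `w` to a unit and extends to the localization `H`.
      let pre : (𝟙_ (Over (Spec (.of K))) ⟶ (Spec (.of A)).asOver (Spec (.of K))) →*
          ((Spec (.of K)).asOver (Spec (.of K)) ⟶ (Spec (.of A)).asOver (Spec (.of K))) :=
        { toFun := fun y ↦ (terminalIsoSpec K).inv ≫ y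
          map_one' := MonObj.comp_one _
          map_mul' := fun y z ↦ MonObj.comp_mul _ _ _ }
      let a : WithConv (A →ₐ[K] K) := Spec.mapMulEquiv.symm (pre x)
      have hax : Spec.mapMulEquiv a = pre x := Spec.mapMulEquiv.apply_symm_apply _
      have ha : IsUnit (a.ofConv w) := isUnit_apply_of_isUnit hw
        ((hx.map pre).map Spec.mapMulEquiv.symm)
      let := (f : A →ₐ[K] H).toRingHom.toAlgebra
      have : IsScalarTower K A H := .of_algebraMap_eq fun r ↦
        ((f : A →ₐ[K] H).commutes r).symm
      let b : H →ₐ[K] K := IsLocalization.liftAlgHom (M := Submonoid.powers w) (f := a.ofConv)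
        (by
          rintro ⟨_, n, rfl⟩
          rw [map_pow]
          exact ha.pow n)
      have hb : b.comp (f : A →ₐ[K] H) = a.ofConv := AlgHom.ext fun y ↦
        IsLocalization.lift_eq _ y
      refine ⟨(terminalIsoSpec K).hom ≫ Spec.mapMulEquiv (.toConv b), ?_⟩
      rw [Category.assoc, ← Iso.eq_inv_comp]
      refine Eq.trans ?_ hax
      ext1
      change Spec.map (CommRingCat.ofHom b.toRingHom) ≫
        Spec.map (CommRingCat.ofHom (f : A →ₐ[K] H).toRingHom) =
          Spec.map (CommRingCat.ofHom a.ofConv.toRingHom)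
      rw [← Spec.map_comp, ← CommRingCat.ofHom_comp, ← hb]
      rfl
    · rintro ⟨g, rfl⟩
      have := isMonHom_specHom f
      exact (Group.isUnit g).map (IsMonHom.monoidHom (specHom f) _)

end Spec
/-- A subalgebra `A` of a commutative Hopf algebra `H` that is closed under the comultiplication and
of which `H` is the localization at a group-like element is the coordinate ring of an affine
algebraic monoid with group of invertible elements `Spec H`. -/
theorem exists_monObj_isUnitGroup {K A H : Type u} [Field K] [CommRing A] [Algebra K A] [CommRing H]
    [HopfAlgebra K H] (f : A →ₐ[K] H) (hf : Function.Injective f) (Δ : A →ₐ[K] A ⊗[K] A)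
    (hΔ : (Algebra.TensorProduct.map f f).comp Δ = (Bialgebra.comulAlgHom K H).comp f)
    {w : A} (hw : IsGroupLikeElem K (f w))
    (hloc : letI := f.toRingHom.toAlgebra; IsLocalization.Away w H) :
    ∃ (μX : MonObj ((Spec (.of A)).asOver (Spec (.of K))))
      (j : (Spec (.of H)).asOver (Spec (.of K)) ⟶ (Spec (.of A)).asOver (Spec (.of K))),
      μX.mul.left = (pullbackSpecIso K A A).hom ≫ Spec.map (CommRingCat.ofHom Δ.toRingHom) ∧
        IsUnitGroup j := by
  let _ : Bialgebra K A := bialgebraOfInjective f hf Δ hΔ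
  let F : A →ₐc[K] H := BialgHom.ofAlgHom f rfl hΔ
  have hwA : IsGroupLikeElem K w :=
    { counit_eq_one := hw.counit_eq_one
      comul_eq_tmul_self := by
        apply tensorMap_injective hf hf
        refine (DFunLike.congr_fun hΔ w).trans ?_
        rw [Algebra.TensorProduct.map_tmul]
        exact hw.comul_eq_tmul_self }
  exact ⟨inferInstance, specHom F, rfl, isUnitGroup_specHom F hwA hloc⟩

/-! ### Existence of the root monoid, of `φ` and of the roots. -/

section

variable {K : Type u} [Field K] {N : Type u} [AddCommGroup N] {k : ℕ}
  {σ : PointedCone ℚ (ℚ ⊗[ℤ] N)} {p : Fin k → N} {e₁ e₂ : Fin k → Module.Dual ℤ N}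
  {O : AddSubmonoid (Module.Dual ℤ N)} {w : Module.Dual ℤ N} {L : Type u} [AddCommGroup L]

theorem exists_isRootMonoid (hO : IsRegularFaceData σ p O w)
    (h₁ : ∀ r s, e₁ r (p s) = if r = s then -1 else 0)
    (h₂ : ∀ r s, e₂ r (p s) = if r = s then -1 else 0)
    (m₁ : ∀ r, e₁ r ∈ O) (m₂ : ∀ r, e₂ r ∈ O) (χ : Fin k → L)
    (φ : L ≃ₗ[ℤ] perp (coneOf (Set.range p))) (hφ : ∀ r, e₂ r - e₁ r = φ (χ r)) :
    ∃ (μX : MonObj (toricVariety K σ)) (j : semidirectGroup K χ ⟶ toricVariety K σ),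
      IsRootMonoid σ p e₁ e₂ μX ∧ IsUnitGroup j := by
  obtain ⟨Δ, hΔ⟩ := exists_comul (K := K) hO h₁ h₂ m₁ m₂
  have hw : IsGroupLikeElem K (chart K χ φ hO h₁ (supportFunction K hO)) := by
    rw [chart_supportFunction]
    exact ⟨SemidirectRing.counitHom_char K χ _, SemidirectRing.comulHom_char K χ _⟩
  obtain ⟨μX, j, hμ, hj⟩ := exists_monObj_isUnitGroup (chart K χ φ hO h₁)
    (chart_injective K χ φ hO h₁) Δ (map_chart_comp_comul K χ φ hO h₁ hφ hΔ) hw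
    (isLocalization_chart K χ φ hO h₁)
  refine ⟨μX, j, ⟨Δ, fun u ↦ ?_, hμ⟩, hj⟩
  exact (DFunLike.congr_fun hΔ _).trans (laurentComul_single hO u)

/-- An element of `τ^⊥ ∩ M` is determined by its arbitrary values on the remaining `m` basis
vectors. -/
theorem exists_equiv_perp [Module.Free ℤ L] [Module.Finite ℤ L] {m : ℕ}
    (b : Module.Basis (Fin k ⊕ Fin m) ℤ N) (hb : ∀ r, b (Sum.inl r) = p r)
    (hL : Module.finrank ℤ L = m) : Nonempty (L ≃ₗ[ℤ] perp (coneOf (Set.range p))) := by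
  let f : perp (coneOf (Set.range p)) →ₗ[ℤ] (Fin m → ℤ) :=
    { toFun := fun u i ↦ (u : Module.Dual ℤ N) (b (Sum.inr i))
      map_add' := fun _ _ ↦ rfl
      map_smul' := fun _ _ ↦ rfl }
  have hf : Function.Bijective f := by
    constructor
    · intro u v huv
      refine Subtype.ext (b.ext ?_)
      rintro (r | i)
      · rw [hb, mem_perp_coneOf_range.1 u.2, mem_perp_coneOf_range.1 v.2]
      · exact congrFun huv i
    · intro c
      refine ⟨⟨b.constr ℤ (Sum.elim 0 c), mem_perp_coneOf_range.2 fun s ↦ ?_⟩, ?_⟩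
      · rw [← hb, b.constr_basis]
        rfl
      · ext i
        exact b.constr_basis ℤ _ _
  exact ⟨(Module.finBasisOfFinrankEq ℤ L hL).equivFun.trans (LinearEquiv.ofBijective f hf).symm⟩

theorem exists_compatible_roots [Module.Free ℤ N] {G : Finset (ℚ ⊗[ℤ] N)} {m : ℕ}
    (b : Module.Basis (Fin k ⊕ Fin m) ℤ N) (hb : ∀ r, b (Sum.inl r) = p r)
    (hw : w ∈ dualSemigroup (PointedCone.hull ℚ (G : Set (ℚ ⊗[ℤ] N))))
    (hface : ∀ v, v ∈ coneOf (Set.range p) ↔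
      v ∈ PointedCone.hull ℚ (G : Set (ℚ ⊗[ℤ] N)) ∧ pairing w v = 0)
    (d : Fin k → perp (coneOf (Set.range p))) :
    ∃ e₁ e₂ : Fin k → Module.Dual ℤ N,
      AreCompatibleRoots (PointedCone.hull ℚ (G : Set (ℚ ⊗[ℤ] N))) p e₁ e₂ ∧
      (∀ r, e₂ r - e₁ r = d r) ∧
      (∀ r, e₁ r ∈ offFace G (coneOf (Set.range p))) ∧
      ∀ r, e₂ r ∈ offFace G (coneOf (Set.range p)) := by
  have hO := isRegularFaceData_offFace hw hface
  have hray := isRayVector_of_basis b hb hO hface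
  have hsub : coneOf (Set.range p) ≤ PointedCone.hull ℚ (G : Set (ℚ ⊗[ℤ] N)) :=
    fun v hv ↦ ((hface v).1 hv).1
  -- The roots are these two functionals, both shifted by `n r • w`.
  choose n hn₁ hn₂ using fun r ↦
    hO.exists_pair_mem (-b.coord (Sum.inl r)) (-b.coord (Sum.inl r) + d r)
  have hcoord : ∀ r s, (-b.coord (Sum.inl r)) (p s) = if r = s then -1 else 0 := by
    intro r s
    rw [← hb]
    simp only [LinearMap.neg_apply, Module.Basis.coord_apply, Module.Basis.repr_self,
      Finsupp.single_apply, Sum.inl.injEq, eq_comm (a := s)]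
    split_ifs <;> simp
  have h₁ : ∀ r s, (-b.coord (Sum.inl r) + n r • w) (p s) = if r = s then -1 else 0 := by
    intro r s
    rw [hO.add_nsmul_apply, hcoord]
  have h₂ : ∀ r s, (-b.coord (Sum.inl r) + d r + n r • w) (p s) = if r = s then -1 else 0 := by
    intro r s
    rw [hO.add_nsmul_apply, LinearMap.add_apply, hcoord, mem_perp_coneOf_range.1 (d r).2, add_zero]
  exact ⟨_, _, ⟨fun r ↦ isDemazureRoot_of_mem_offFace hray hsub (hn₁ r) (h₁ r),
    fun r ↦ isDemazureRoot_of_mem_offFace hray hsub (hn₂ r) (h₂ r), h₁, h₂⟩,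
    fun r ↦ by abel, hn₁, hn₂⟩

end

end RootMonoid

end

theorem proposition4p5
    {K : Type u} [Field K] [IsAlgClosed K] [CharZero K]
    {N : Type u} [AddCommGroup N] [Module.Free ℤ N] [Module.Finite ℤ N]
    (σ τ : PointedCone ℚ (ℚ ⊗[ℤ] N)) (hfg : σ.FG)
    (hsalient : (σ : ConvexCone ℚ (ℚ ⊗[ℤ] N)).Salient)
    {k : ℕ} (p : Fin k → N) (hface : RootMonoid.IsFace τ σ) (hreg : RootMonoid.IsRegularCone p τ)
    {L : Type u} [AddCommGroup L] [Module.Free ℤ L] [Module.Finite ℤ L]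
    (hdim : k + Module.finrank ℤ L = Module.finrank ℤ N) (χ : Fin k → L) :
    (∃ (_ : MonObj (RootMonoid.toricVariety K σ))
        (j : RootMonoid.semidirectGroup K χ ⟶ RootMonoid.toricVariety K σ),
      RootMonoid.IsUnitGroup j) ∧
    ∀ φ : L ≃ₗ[ℤ] RootMonoid.perp τ,
      ∃ e₁ e₂ : Fin k → Module.Dual ℤ N,
        RootMonoid.AreCompatibleRoots σ p e₁ e₂ ∧
        (∀ r, e₂ r - e₁ r = φ (χ r)) ∧
        ∃ (μX : MonObj (RootMonoid.toricVariety K σ))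
        (j : RootMonoid.semidirectGroup K χ ⟶ RootMonoid.toricVariety K σ),
          RootMonoid.IsRootMonoid σ p e₁ e₂ μX ∧ RootMonoid.IsUnitGroup j := by
  obtain ⟨G, rfl⟩ := hfg
  obtain ⟨⟨m, b, hb⟩, rfl⟩ := hreg
  obtain ⟨w, hw, hτ⟩ := hface
  have hO := RootMonoid.isRegularFaceData_offFace hw hτ
  -- The first assertion follows from the second, since equality of ranks provides some `φ`.
  refine (and_iff_right_of_imp fun main ↦ ?_).2 fun φ ↦ ?_
  · have hN : Module.finrank ℤ N = k + m := by
      simp [Module.finrank_eq_card_basis b]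
    obtain ⟨φ⟩ := RootMonoid.exists_equiv_perp (L := L) b hb (by omega)
    obtain ⟨_, _, -, -, μX, j, -, hj⟩ := main φ
    exact ⟨μX, j, hj⟩
  · obtain ⟨e₁, e₂, he, hd, m₁, m₂⟩ :=
      RootMonoid.exists_compatible_roots b hb hw hτ fun r ↦ φ (χ r)
    exact ⟨e₁, e₂, he, hd,
      RootMonoid.exists_isRootMonoid (K := K) hO he.apply₁ he.apply₂ m₁ m₂ χ φ hd⟩
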